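/- **Theorem 4.1.** Fix integers $D,R\ge 0$. For every sample size $n$ let $p_{1,n},\dots,p_{D,n}$ be tensor dimensions with $R\sum_{j=1}^D p_{j,n}=o(n)$, and let $\boldsymbol X_1,\dots,\boldsymbol X_n\in\mathbb R^{p_{1,n}\times\cdots\times p_{D,n}}$ be fixed tensor predictors (which may depend on $n$). For margins $\boldsymbol F=(\boldsymbol\beta_j^{(r)})_{j\le D,\,r\le R}$ with $\boldsymbol\beta_j^{(r)}\in\mathbb R^{p_{j,n}}$, put $\boldsymbol B(\boldsymbol F)=\sum_{r=1}^R\boldsymbol\beta_1^{(r)}\circ\cdots\circ\boldsymbol\beta_D^{(r)}$, where $\circ$ is the outer product. Under the parameter $\boldsymbol B_n=\boldsymbol B(\boldsymbol F_n)$ the data $\boldsymbol y_n=(y_1,\dots,y_n)$ are independent with $y_i\sim N(\langle\boldsymbol X_i,\boldsymbol B_n\rangle,1)$; write $f(y_i\mid\boldsymbol B_n)$ and $f(\boldsymbol y_n\mid\boldsymbol B_n)$ for the densities of $y_i$ and $\boldsymbol y_n$. Let $\boldsymbol B_n^0=\boldsymbol B(\boldsymbol F_n^0)$ be the true tensor,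 and let the data $\boldsymbol y_n$, $n\ge1$, be defined on a common probability space, $\boldsymbol y_n$ having its law under $\boldsymbol B_n^0$ for each $n$ (with any joint dependence between different $n$). Let $\pi_n$ be a probability measure (the prior) on the margins $\boldsymbol F_n$. For a set $A$ of tensors, write $\pi_n(A)$ for the prior mass of $\{\boldsymbol F_n:\boldsymbol B(\boldsymbol F_n)\in A\}$, and let $$\Pi_n(A)=\frac{\int_{\{\boldsymbol B(\boldsymbol F_n)\in A\}}f(\boldsymbol y_n\mid \boldsymbol B(\boldsymbol F_n))\,d\pi_n(\boldsymbol F_n)}{\int f(\boldsymbol y_n\mid \boldsymbol B(\boldsymbol F_n))\,d\pi_n(\boldsymbol F_n)}$$ be its posterior mass. Let $\rho_3>0$, $\zeta_n=n^{(1+\rho_3)/2}$, $M_n=\frac1n\sqrt{\sum_{i=1}^n\|\boldsymbol X_i\|_2^2}$, and $\mathrm{KL}_i=\mathrm{KL}\big(f(y_i\mid\boldsymbol B_n^0),f(y_i\mid\boldsymbol B_n)\big)$. Let $\epsilon>0$, $d>0$ and $\eta<\frac{\epsilon}{32}-d$. If $$\pi_n\Big(\boldsymbol B_n:\ \|\boldsymbol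 B_n-\boldsymbol B_n^0\|_2<\frac{2\eta}{3M_n\zeta_n}\Big)>\exp(-dn)\qquad\text{for all large }n$$ (where the inequality is read as $3M_n\zeta_n\|\boldsymbol B_n-\boldsymbol B_n^0\|_2<2\eta$ if $M_n=0$), then $$\Pi_n\Big(\boldsymbol B_n:\ \frac1n\sum_{i=1}^n\mathrm{KL}_i>\epsilon\Big)\to0\quad\text{almost surely as }n\to\infty .$$ -/

import Mathlib

open MeasureTheory ProbabilityTheory Filter Topology Asymptotics
open scoped ENNReal

noncomputable section

namespace TensorRegression

/-- Real `D`-way tensors of dimensions `p 0 × ⋯ × p (D - 1)`. The norm is the Euclidean norm of the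
array of entries (`‖·‖₂`), and `inner ℝ X B` is `⟨X, B⟩ = vec(X)ᵀ vec(B)`. -/
abbrev Tensor {D : ℕ} (p : Fin D → ℕ) : Type :=
  EuclideanSpace ℝ ((j : Fin D) → Fin (p j))

/-- The tensor margins `β_j^{(r)} ∈ ℝ^{p_j}`, `1 ≤ r ≤ R`, `1 ≤ j ≤ D`: the parameter vector `F`. -/
abbrev Margins (R : ℕ) {D : ℕ} (p : Fin D → ℕ) : Type :=
  Fin R → (j : Fin D) → Fin (p j) → ℝ

/-- The rank-`R` parafac tensor `B = ∑_r β_1^{(r)} ∘ ⋯ ∘ β_D^{(r)}`. -/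
def parafac {R D : ℕ} {p : Fin D → ℕ} (F : Margins R p) : Tensor p :=
  WithLp.toLp 2 fun k => ∑ r, ∏ j, F r j (k j)

variable {n D : ℕ} {p : Fin D → ℕ}

/-- The law of one response under the model: `y_i ~ N(⟨X_i, B⟩, 1)`. -/
def responseLaw (X : Fin n → Tensor p) (B : Tensor p) (i : Fin n) : Measure ℝ :=
  gaussianReal (inner ℝ (X i) B) 1

/-- The law of the data `(y_1, …, y_n)` under `B`: independent coordinates `N(⟨X_i, B⟩, 1)`. -/
def dataLaw (X : Fin n → Tensor p) (B : Tensor p) : Measure (Fin n → ℝ) :=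
  Measure.pi (responseLaw X B)

/-- The density `f(y | B)` of the data with respect to Lebesgue measure. -/
def likelihood (X : Fin n → Tensor p) (B : Tensor p) (y : Fin n → ℝ) : ℝ≥0∞ :=
  ∏ i, gaussianPDF (inner ℝ (X i) B) 1 (y i)

/-- `(1/n) ∑_i KL(f(y_i | B₀), f(y_i | B))`. -/
def avgKL (X : Fin n → Tensor p) (B₀ B : Tensor p) : ℝ≥0∞ :=
  (∑ i, InformationTheory.klDiv (responseLaw X B₀ i) (responseLaw X B i)) / n

/-- The posterior mass of the set `A` of margins given the data `y`, for the prior `π` on the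
margins: `∫_A f(y | B) dπ / ∫ f(y | B) dπ`, where `B` is the parafac tensor of the margins. -/
def posteriorMass {R : ℕ} (X : Fin n → Tensor p) (π : Measure (Margins R p)) (y : Fin n → ℝ)
    (A : Set (Margins R p)) : ℝ≥0∞ :=
  (∫⁻ F in A, likelihood X (parafac F) y ∂π) / ∫⁻ F, likelihood X (parafac F) y ∂π

/-- `M_n = (1/n) √(∑_i ‖X_i‖₂²)`. -/
def designSize (X : Fin n → Tensor p) : ℝ :=
  1 / n * √(∑ i, ‖X i‖ ^ 2)

/-- `ζ_n = n^{(1 + ρ) / 2}`. -/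
def zeta (ρ : ℝ) (n : ℕ) : ℝ :=
  (n : ℝ) ^ ((1 + ρ) / 2)

/-- The set of margins whose tensor `B` satisfies `‖B - B₀‖₂ < 2η / (3 M_n ζ_n)`. The inequality is
written without the division, so that a vanishing design (`M_n = 0`) gives radius `∞`, not `0`. -/
def priorBall {R : ℕ} (X : Fin n → Tensor p) (B₀ : Tensor p) (ρ η : ℝ) : Set (Margins R p) :=
  {F | 3 * designSize X * zeta ρ n * ‖parafac F - B₀‖ < 2 * η}

end TensorRegression

end

/-!
Write `e_i = y_i - ⟨X_i, B₀⟩` for the noise and `δ(F)_i = ⟨X_i, B(F) - B₀⟩` for the shift of the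
means. The likelihood ratio of `B(F)` to `B₀` is `exp (⟨e, δ⟩ - ‖δ‖² / 2)` (`likelihood_eq`), and
the average Kullback–Leibler divergence is `‖δ‖² / (2 n)` (`avgKL_eq`). The theorem therefore
follows once, almost surely for all large `n`,

  `⟨e, δ(F)⟩² ≤ τ n ‖δ(F)‖²` for *all* margins `F`, with `τ = ε / 8`.      (*)

Where the divergence exceeds `ε`, (*) bounds the likelihood ratio by `exp (-ε n / 2)`; on the prior
ball `‖δ‖² = o(n)`, so (*) bounds it below by `exp (-5 ε n / 64)`; and the prior mass of the ball is
at least `exp (-d n)` with `d < ε / 32` (`posteriorMass_le`).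

The margins range over an unbounded set and the design may be arbitrarily ill-conditioned, so (*)
is not obtained from covering numbers in the parameter space. Instead, consider the functions
`y ↦ ⟨e, δ(F)⟩ ^ k`. They depend polynomially on `F`, with degree at most `k D` in `m = R ∑ p_j`
variables, so that they span a space of dimension `N` at most the number of monomials of that degree
(`finrank_span_eval_le`). In a space of dimension `N` in `L²`, every `f` satisfies `f² ≤ ‖f‖² S` for
one envelope `S` of integral at most `N` (`exists_christoffel`). As
`‖⟨e, δ⟩ ^ k‖² ≤ 2 (2 e k ‖δ‖²) ^ k` (`gaussian_pairing_moment`, where the `e` on the right is the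
base of the exponential), Markov's inequality for `S` bounds the probability that (*) fails for some
`F` by `2 N (2 e k / (τ n)) ^ k` (`dataLaw_exists_lt_sq_le`). With `k` a small multiple of `n` and
`m = o(n)`, the number `N` is too small to compensate the second factor, the bound decays
exponentially (`eventually_dataLaw_exists_lt_sq_le`), and the Borel–Cantelli lemma gives (*).
-/

namespace TensorRegression

/-! ### Gaussian likelihoods and divergences -/

/-- For Gaussians of unit variance the log-likelihood ratio is affine in the observation. -/
theorem klDiv_gaussianReal_one (a b : ℝ) :
    InformationTheory.klDiv (gaussianReal a 1) (gaussianReal b 1) =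
      ENNReal.ofReal ((b - a) ^ 2 / 2) := by
  have hv : (1 : NNReal) ≠ 0 := one_ne_zero
  have hac : gaussianReal a 1 ≪ gaussianReal b 1 :=
    (gaussianReal_absolutelyContinuous a hv).trans (gaussianReal_absolutelyContinuous' b hv)
  have hllr : llr (gaussianReal a 1) (gaussianReal b 1) =ᵐ[gaussianReal a 1]
      fun x => (b ^ 2 - a ^ 2) / 2 + (a - b) * x := by
    filter_upwards [hac.ae_le (Measure.rnDeriv_eq_div
      (gaussianReal_absolutelyContinuous a hv) (gaussianReal_absolutelyContinuous b hv)),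
      (gaussianReal_absolutelyContinuous a hv).ae_le (rnDeriv_gaussianReal a 1),
      (gaussianReal_absolutelyContinuous a hv).ae_le (rnDeriv_gaussianReal b 1)] with x h1 h2 h3
    have ha := gaussianPDFReal_pos a 1 x hv
    have hb := gaussianPDFReal_pos b 1 x hv
    rw [llr, h1, h2, h3, ENNReal.toReal_div, toReal_gaussianPDF, toReal_gaussianPDF]
    simp only [gaussianPDFReal]
    rw [mul_div_mul_left _ _ (by positivity), ← Real.exp_sub, Real.log_exp]
    push_cast
    ring
  have hid : Integrable (fun x : ℝ => x) (gaussianReal a 1) :=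
    (memLp_id_gaussianReal 1).integrable le_rfl
  have hint : Integrable (fun x => (b ^ 2 - a ^ 2) / 2 + (a - b) * x) (gaussianReal a 1) :=
    (integrable_const _).add (hid.const_mul _)
  rw [InformationTheory.klDiv_of_ac_of_integrable hac (hint.congr hllr.symm),
    integral_congr_ae hllr, integral_add (integrable_const _) (hid.const_mul _), integral_const_mul]
  rw [integral_id_gaussianReal]
  congr 1
  simp
  ring

variable {n D R : ℕ} {p : Fin D → ℕ}

/-- The difference `δ_i = ⟨X_i, B⟩ - ⟨X_i, B₀⟩` of the `i`-th means under `B` and `B₀`. -/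
noncomputable def meanShift (X : Fin n → Tensor p) (B₀ B : Tensor p) (i : Fin n) : ℝ :=
  inner ℝ (X i) B - inner ℝ (X i) B₀

/-- The squared Euclidean length `‖δ‖²` of the mean shift. -/
noncomputable def sqShift (X : Fin n → Tensor p) (B₀ B : Tensor p) : ℝ :=
  ∑ i, meanShift X B₀ B i ^ 2

/-- The pairing `⟨e, δ⟩` of the noise `e_i = y_i - ⟨X_i, B₀⟩` with the mean shift. -/
noncomputable def noisePairing (X : Fin n → Tensor p) (B₀ B : Tensor p) (y : Fin n → ℝ) : ℝ :=
  ∑ i, (y i - inner ℝ (X i) B₀) * meanShift X B₀ B i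

theorem avgKL_eq (X : Fin n → Tensor p) (B₀ B : Tensor p) :
    avgKL X B₀ B = ENNReal.ofReal (sqShift X B₀ B / 2) / n := by
  simp only [sqShift, avgKL, responseLaw, klDiv_gaussianReal_one]
  rw [← ENNReal.ofReal_sum_of_nonneg fun i _ => by positivity, Finset.sum_div]
  rfl

theorem likelihood_eq (X : Fin n → Tensor p) (B₀ B : Tensor p) (y : Fin n → ℝ) :
    likelihood X B y = likelihood X B₀ y * ENNReal.ofReal (Real.exp
      (noisePairing X B₀ B y - sqShift X B₀ B / 2)) := by
  unfold likelihood noisePairing sqShift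
  rw [Finset.sum_div, ← Finset.sum_sub_distrib, Real.exp_sum,
    ENNReal.ofReal_prod_of_nonneg fun i _ => (Real.exp_pos _).le, ← Finset.prod_mul_distrib]
  refine Finset.prod_congr rfl fun i _ => ?_
  rw [gaussianPDF, gaussianPDF, ← ENNReal.ofReal_mul (gaussianPDFReal_nonneg _ _ _),
    gaussianPDFReal, gaussianPDFReal, mul_assoc _ (Real.exp _), ← Real.exp_add]
  congr 3
  simp [meanShift]
  ring

/-! ### A maximal inequality for function spaces of finite dimension -/

section FiniteRank

variable {α : Type*} [MeasurableSpace α] {μ : Measure α}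

/-- A space of square-integrable functions of dimension `N` has an envelope `S` (the diagonal of its
reproducing kernel, `∑ w_i²` for an orthonormal basis `w_i`) with `f² ≤ ‖f‖² S` for all its members
and `∫ S ≤ N`. The dimension can drop on passing to classes of functions in `L²`, whence the
inequality. -/
theorem exists_christoffel (V : Submodule ℝ (α → ℝ)) [FiniteDimensional ℝ V]
    (hV : ∀ f ∈ V, MemLp f 2 μ) :
    ∃ S : α → ℝ, Integrable S μ ∧ (∀ x, 0 ≤ S x) ∧ ∫ x, S x ∂μ ≤ Module.finrank ℝ V ∧
      ∀ f ∈ V, ∀ᵐ x ∂μ, f x ^ 2 ≤ (∫ z, f z ^ 2 ∂μ) * S x := by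
  let T : V →ₗ[ℝ] Lp ℝ 2 μ :=
    { toFun := fun f => (hV f f.2).toLp f
      map_add' := fun f g => MemLp.toLp_add (hV f f.2) (hV g g.2)
      map_smul' := fun c f => MemLp.toLp_const_smul c (hV f f.2) }
  let b := stdOrthonormalBasis ℝ (LinearMap.range T)
  have hsq (g : Lp ℝ 2 μ) : ∫ x, g x ^ 2 ∂μ = ‖g‖ ^ 2 := by
    rw [← real_inner_self_eq_norm_sq, L2.inner_def]
    simp [pow_two]
  have hint (g : Lp ℝ 2 μ) : Integrable (fun x => g x ^ 2) μ := (Lp.memLp g).integrable_sq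
  refine ⟨fun x => ∑ i, ((b i : Lp ℝ 2 μ) : α → ℝ) x ^ 2,
    integrable_finsetSum _ fun i _ => hint _, fun x => Finset.sum_nonneg fun i _ => sq_nonneg _,
    ?_, ?_⟩
  · rw [integral_finsetSum _ fun i _ => hint _]
    have h1 : ∀ i, ‖(b i : Lp ℝ 2 μ)‖ = 1 := fun i => b.norm_eq_one i
    simp only [hsq, h1]
    simpa using LinearMap.finrank_range_le T
  · intro f hf
    let w : LinearMap.range T := ⟨T ⟨f, hf⟩, ⟨f, hf⟩, rfl⟩
    have hw : (w : Lp ℝ 2 μ) = ∑ i, inner ℝ (b i) w • (b i : Lp ℝ 2 μ) := by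
      conv_lhs => rw [← b.sum_repr' w]
      simp
    have h1 : ((w : Lp ℝ 2 μ) : α → ℝ) =ᵐ[μ]
        fun x => ∑ i, inner ℝ (b i) w * ((b i : Lp ℝ 2 μ) : α → ℝ) x := by
      rw [hw]
      refine (Lp.coeFn_fun_finsetSum _ _).trans ?_
      have : ∀ᵐ x ∂μ, ∀ i, ((inner ℝ (b i) w • (b i : Lp ℝ 2 μ) : Lp ℝ 2 μ) : α → ℝ) x
          = inner ℝ (b i) w * ((b i : Lp ℝ 2 μ) : α → ℝ) x :=
        ae_all_iff.2 fun i => (Lp.coeFn_smul _ _).mono fun x hx => by simpa [smul_eq_mul] using! hx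
      filter_upwards [this] with x hx
      exact Finset.sum_congr rfl fun i _ => hx i
    have h2 : ((w : Lp ℝ 2 μ) : α → ℝ) =ᵐ[μ] f := (hV f hf).coeFn_toLp
    have h3 : ∫ z, f z ^ 2 ∂μ = ∑ i, inner ℝ (b i) w ^ 2 := by
      rw [integral_congr_ae (h2.mono fun x hx => by simp only [hx] :
        (fun z => f z ^ 2) =ᵐ[μ] fun z => ((w : Lp ℝ 2 μ) : α → ℝ) z ^ 2), hsq]
      have := b.sum_sq_norm_inner_right w
      simpa using this.symm
    filter_upwards [h1, h2] with x hx1 hx2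
    rw [h3, ← hx2, hx1]
    exact Finset.sum_mul_sq_le_sq_mul_sq _ _ _

/-- Maximal inequality for a family of functions of finite rank: the union bound over an infinite
index set costs no more than the dimension of the span. Continuity in the index makes a countable
set of indices, hence a single null set, suffice. -/
theorem measure_exists_lt_sq_le {ι : Type*} [TopologicalSpace ι] [TopologicalSpace.SeparableSpace ι]
    {f : ι → α → ℝ} {C : ι → ℝ} (hf : ∀ x, Continuous fun i => f i x) (hC : Continuous C)
    (hL : ∀ i, MemLp (f i) 2 μ) (hfC : ∀ i, ∫ x, f i x ^ 2 ∂μ ≤ C i)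
    [FiniteDimensional ℝ (Submodule.span ℝ (Set.range f))] {t : ℝ} (ht : 0 < t) :
    μ {x | ∃ i, t * C i < f i x ^ 2} ≤
      ENNReal.ofReal (Module.finrank ℝ (Submodule.span ℝ (Set.range f)) / t) := by
  have hV : ∀ g ∈ Submodule.span ℝ (Set.range f), MemLp g 2 μ := fun g hg => by
    induction hg using Submodule.span_induction with
    | mem g hg => obtain ⟨i, rfl⟩ := hg; exact hL i
    | zero => exact MemLp.zero
    | add g h _ _ hg hh => exact hg.add hh
    | smul c g _ hg => exact hg.const_smul c
  obtain ⟨S, hSi, hS0, hSN, hS⟩ := exists_christoffel _ hV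
  obtain ⟨s, hsc, hsd⟩ := TopologicalSpace.exists_countable_dense ι
  have hae : ∀ᵐ x ∂μ, ∀ i ∈ s, f i x ^ 2 ≤ C i * S x := by
    rw [ae_ball_iff hsc]
    intro i _
    filter_upwards [hS (f i) (Submodule.subset_span ⟨i, rfl⟩)] with x hx
    exact hx.trans (mul_le_mul_of_nonneg_right (hfC i) (hS0 x))
  have hC0 : ∀ i, 0 ≤ C i := fun i => (integral_nonneg fun x => sq_nonneg _).trans (hfC i)
  calc μ {x | ∃ i, t * C i < f i x ^ 2}
      ≤ μ {x | ENNReal.ofReal t ≤ ENNReal.ofReal (S x)} := by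
        refine measure_mono_ae ?_
        filter_upwards [hae] with x hx
        rintro ⟨i, hi⟩
        -- the strict inequality is an open condition on the index, so it holds on the dense set
        obtain ⟨j, hjs, hj⟩ := hsd.exists_mem_open
          (isOpen_lt (continuous_const.mul hC) ((hf x).pow 2)) ⟨i, hi⟩
        refine ENNReal.ofReal_le_ofReal (le_of_not_gt fun hlt => ?_)
        have h1 : t * C j < f j x ^ 2 := hj
        nlinarith [hx j hjs, hC0 j]
    _ ≤ (∫⁻ x, ENNReal.ofReal (S x) ∂μ) / ENNReal.ofReal t :=
        meas_ge_le_lintegral_div hSi.aestronglyMeasurable.aemeasurable.ennreal_ofReal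
          (by simpa using ht) ENNReal.ofReal_ne_top
    _ ≤ _ := by
        rw [← ofReal_integral_eq_lintegral_ofReal hSi (ae_of_all _ hS0),
          ← ENNReal.ofReal_div_of_pos ht]
        gcongr

end FiniteRank

/-! ### Counting monomials -/

section Counting

variable {σ : Type*} [Fintype σ]

/-- The number of monomials of degree at most `K`. Each of them is given the weight
`x ^ (degree - K) ≥ 1`, and the total weight of all monomials with exponents at most `K` is a
product of geometric sums. -/
theorem card_filter_sum_le [DecidableEq σ] (K : ℕ) {x : ℝ} (hx0 : 0 < x) (hx1 : x < 1) :
    (((Fintype.piFinset fun _ : σ => Finset.range (K + 1)).filter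
      fun d => ∑ s, d s ≤ K).card : ℝ) ≤ x⁻¹ ^ K * (1 - x)⁻¹ ^ Fintype.card σ := by
  have hgeom : ∑ a ∈ Finset.range (K + 1), x ^ a ≤ (1 - x)⁻¹ := by
    rw [geom_sum_eq hx1.ne, ← neg_div_neg_eq, neg_sub, neg_sub, div_eq_mul_inv]
    have := inv_nonneg.2 (sub_pos.2 hx1).le
    have := pow_pos hx0 (K + 1)
    nlinarith
  calc _ = ∑ d ∈ (Fintype.piFinset fun _ : σ => Finset.range (K + 1)).filter
        fun d => ∑ s, d s ≤ K, (1 : ℝ) := by simp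
    _ ≤ ∑ d ∈ (Fintype.piFinset fun _ : σ => Finset.range (K + 1)).filter
        fun d => ∑ s, d s ≤ K, x⁻¹ ^ K * ∏ s, x ^ d s := by
        refine Finset.sum_le_sum fun d hd => ?_
        rw [Finset.prod_pow_eq_pow_sum, inv_pow, inv_mul_eq_div, one_le_div (pow_pos hx0 _)]
        exact pow_le_pow_of_le_one hx0.le hx1.le (Finset.mem_filter.1 hd).2
    _ ≤ ∑ d ∈ Fintype.piFinset fun _ : σ => Finset.range (K + 1), x⁻¹ ^ K * ∏ s, x ^ d s :=
        Finset.sum_le_sum_of_subset_of_nonneg (Finset.filter_subset _ _)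
          fun d _ _ => by positivity
    _ = x⁻¹ ^ K * (∑ a ∈ Finset.range (K + 1), x ^ a) ^ Fintype.card σ := by
        rw [← Finset.mul_sum, ← Finset.prod_univ_sum]
        simp
    _ ≤ _ := by gcongr

/-- Polynomials of degree at most `K` whose coefficients depend on a parameter `a`, evaluated
at a fixed point and viewed as functions of `a`, lie in the span of the coefficient functions. -/
theorem finrank_span_eval_le {α : Type*} (P : α → MvPolynomial σ ℝ) {K : ℕ}
    (hP : ∀ a, (P a).totalDegree ≤ K) {x : ℝ} (hx0 : 0 < x) (hx1 : x < 1) :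
    FiniteDimensional ℝ (Submodule.span ℝ
        (Set.range fun (z : σ → ℝ) (a : α) => MvPolynomial.eval z (P a))) ∧
      (Module.finrank ℝ (Submodule.span ℝ
        (Set.range fun (z : σ → ℝ) (a : α) => MvPolynomial.eval z (P a))) : ℝ)
        ≤ x⁻¹ ^ K * (1 - x)⁻¹ ^ Fintype.card σ := by
  classical
  set T : Finset (σ → ℕ) := (Fintype.piFinset fun _ : σ => Finset.range (K + 1)).filter
      fun d => ∑ s, d s ≤ K with hT
  let φ : (σ → ℕ) → α → ℝ := fun d a => (P a).coeff (Finsupp.equivFunOnFinite.symm d)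
  have hle : Submodule.span ℝ
      (Set.range fun (z : σ → ℝ) (a : α) => MvPolynomial.eval z (P a)) ≤
      Submodule.span ℝ (T.image φ : Set (α → ℝ)) := by
    rw [Submodule.span_le]
    rintro _ ⟨z, rfl⟩
    have : (fun a : α => MvPolynomial.eval z (P a)) = ∑ d ∈ T, (∏ s, z s ^ d s) • φ d := by
      ext a
      have hsub : (P a).support ⊆ T.map Finsupp.equivFunOnFinite.symm.toEmbedding := by
        intro m hm
        have h1 : ∑ s, m s ≤ K := by
          have := (MvPolynomial.le_totalDegree hm).trans (hP a)
          rwa [Finsupp.sum_fintype _ _ fun _ => rfl] at this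
        refine Finset.mem_map.2 ⟨Finsupp.equivFunOnFinite m, ?_, by simp⟩
        rw [hT, Finset.mem_filter, Fintype.mem_piFinset]
        refine ⟨fun s => Finset.mem_range.2 ?_, by simpa using h1⟩
        have := Finset.single_le_sum (f := fun s => m s) (fun _ _ => Nat.zero_le _)
          (Finset.mem_univ s)
        simp only [Finsupp.equivFunOnFinite_apply]
        omega
      rw [MvPolynomial.eval_eq', Finset.sum_subset hsub, Finset.sum_map]
      · simp [φ, mul_comm]
      · intro m _ hm
        simp [MvPolynomial.notMem_support_iff.1 hm]
    change (fun a : α => MvPolynomial.eval z (P a)) ∈ _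
    rw [this]
    exact Submodule.sum_mem _ fun d hd => Submodule.smul_mem _ _
      (Submodule.subset_span (by simpa using ⟨d, hd, rfl⟩))
  have hfd : FiniteDimensional ℝ (Submodule.span ℝ (T.image φ : Set (α → ℝ))) :=
    FiniteDimensional.span_finset ℝ _
  refine ⟨Submodule.finiteDimensional_of_le hle, le_trans ?_ (card_filter_sum_le K hx0 hx1)⟩
  exact_mod_cast (Submodule.finrank_mono hle).trans
    ((finrank_span_finset_le_card _).trans Finset.card_image_le)

end Counting

/-! ### Moments of linear functionals of Gaussian noise -/

section GaussianMoments

theorem integral_exp_gaussian_pairing (m u : Fin n → ℝ) (s : ℝ) :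
    Integrable (fun y : Fin n → ℝ => Real.exp (s * ∑ i, (y i - m i) * u i))
      (Measure.pi fun i => gaussianReal (m i) 1) ∧
    ∫ y : Fin n → ℝ, Real.exp (s * ∑ i, (y i - m i) * u i)
      ∂(Measure.pi fun i => gaussianReal (m i) 1) = Real.exp (s ^ 2 * (∑ i, u i ^ 2) / 2) := by
  have hexp : ∀ y : Fin n → ℝ, Real.exp (s * ∑ i, (y i - m i) * u i) =
      ∏ i, Real.exp (-(s * u i * m i)) * Real.exp (s * u i * y i) := fun y => by
    simp only [← Real.exp_add]
    rw [← Real.exp_sum, Finset.mul_sum]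
    congr 1
    exact Finset.sum_congr rfl fun i _ => by ring
  simp only [hexp]
  constructor
  · exact Integrable.fintype_prod
      (f := fun i x => Real.exp (-(s * u i * m i)) * Real.exp (s * u i * x))
      fun i => (integrable_exp_mul_gaussianReal _).const_mul _
  · rw [integral_fintype_prod_eq_prod
      (f := fun i x => Real.exp (-(s * u i * m i)) * Real.exp (s * u i * x))]
    have h1 : ∀ i, ∫ x, Real.exp (-(s * u i * m i)) * Real.exp (s * u i * x)
        ∂(gaussianReal (m i) 1) = Real.exp ((s * u i) ^ 2 / 2) := fun i => by
      rw [integral_const_mul]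
      have := congrFun (mgf_fun_id_gaussianReal (μ := m i) (v := 1)) (s * u i)
      rw [mgf] at this
      rw [this, ← Real.exp_add]
      congr 1
      push_cast
      ring
    simp only [h1]
    rw [← Real.exp_sum, Finset.mul_sum, Finset.sum_div]
    congr 1
    exact Finset.sum_congr rfl fun i _ => by ring

theorem pow_two_mul_le_exp_add_exp (t : ℝ) (k : ℕ) :
    t ^ (2 * k) ≤ (2 * k).factorial * (Real.exp t + Real.exp (-t)) := by
  have h := Real.pow_div_factorial_le_exp |t| (abs_nonneg t) (2 * k)
  rw [div_le_iff₀' (by positivity), (even_two_mul k).pow_abs] at h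
  refine h.trans (mul_le_mul_of_nonneg_left ?_ (by positivity))
  rcases abs_cases t with ⟨h, _⟩ | ⟨h, _⟩ <;> rw [h] <;>
    linarith [Real.exp_pos t, Real.exp_pos (-t)]

/-- The even moments of `⟨e, u⟩`, a centred Gaussian variable of variance `‖u‖²`. -/
theorem gaussian_pairing_moment (m u : Fin n → ℝ) {k : ℕ} (hk : 0 < k) :
    MemLp (fun y : Fin n → ℝ => (∑ i, (y i - m i) * u i) ^ k) 2
      (Measure.pi fun i => gaussianReal (m i) 1) ∧
    ∫ y : Fin n → ℝ, ((∑ i, (y i - m i) * u i) ^ k) ^ 2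
      ∂(Measure.pi fun i => gaussianReal (m i) 1) ≤
      2 * (2 * Real.exp 1 * k * ∑ i, u i ^ 2) ^ k := by
  set Q := Measure.pi fun i => gaussianReal (m i) 1
  set ℓ : (Fin n → ℝ) → ℝ := fun y => ∑ i, (y i - m i) * u i with hℓ
  have hdom : ∀ s : ℝ, Integrable (fun y => ((2 * k).factorial : ℝ) *
      (Real.exp (s * ℓ y) + Real.exp (-(s * ℓ y)))) Q := fun s => by
    have h1 := (integral_exp_gaussian_pairing m u s).1
    have h2 := (integral_exp_gaussian_pairing m u (-s)).1
    simp only [neg_mul] at h2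
    exact (h1.add h2).const_mul _
  have hmeas : AEStronglyMeasurable (fun y => ℓ y ^ k) Q := by
    refine Continuous.aestronglyMeasurable ?_
    fun_prop
  have hint : Integrable (fun y => (ℓ y ^ k) ^ 2) Q := by
    refine (hdom 1).mono' (hmeas.pow 2) (ae_of_all _ fun y => ?_)
    rw [Real.norm_of_nonneg (sq_nonneg _), ← pow_mul, mul_comm k 2]
    simpa using pow_two_mul_le_exp_add_exp (1 * ℓ y) k
  refine ⟨(memLp_two_iff_integrable_sq hmeas).2 hint, ?_⟩
  set U := ∑ i, u i ^ 2 with hU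
  have hU0 : 0 ≤ U := Finset.sum_nonneg fun i _ => sq_nonneg _
  rcases hU0.eq_or_lt with h0 | hpos
  · have hu : ∀ i, u i = 0 := fun i => by
      have := (Finset.sum_eq_zero_iff_of_nonneg fun i _ => sq_nonneg (u i)).1 (hU.symm.trans h0.symm)
        i (Finset.mem_univ i)
      simpa using this
    simp [hu, ← h0, hk.ne']
  have hk' : (0 : ℝ) < k := by exact_mod_cast hk
  -- this `s` minimizes `exp (s² U / 2) / s ^ (2 * k)`, the bound that the moment generating
  -- function gives for the moment of order `2 * k`
  set s := √(2 * k / U) with hs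
  have hs2 : s ^ 2 = 2 * k / U := Real.sq_sqrt (by positivity)
  have hbound : s ^ (2 * k) * ∫ y, (ℓ y ^ k) ^ 2 ∂Q ≤
      (2 * k).factorial * (2 * Real.exp k) := by
    rw [← integral_const_mul]
    calc ∫ y, s ^ (2 * k) * (ℓ y ^ k) ^ 2 ∂Q
        ≤ ∫ y, ((2 * k).factorial : ℝ) * (Real.exp (s * ℓ y) + Real.exp (-(s * ℓ y))) ∂Q := by
          refine integral_mono (hint.const_mul _) (hdom s) fun y => ?_
          have := pow_two_mul_le_exp_add_exp (s * ℓ y) k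
          rwa [mul_pow, mul_comm 2 k, pow_mul (ℓ y), mul_comm k 2] at this
      _ = _ := by
          have h1 := integral_exp_gaussian_pairing m u s
          have h2 := integral_exp_gaussian_pairing m u (-s)
          simp only [neg_mul, neg_sq] at h2
          rw [integral_const_mul, integral_add h1.1 h2.1, h1.2, h2.2, ← hU, hs2]
          congr 1
          rw [show 2 * (k : ℝ) / U * U / 2 = k by field_simp]
          ring
  rw [pow_mul, hs2] at hbound
  have hfac : ((2 * k).factorial : ℝ) ≤ (2 * k) ^ (2 * k) := by
    exact_mod_cast Nat.factorial_le_pow (2 * k)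
  have hpow : (0 : ℝ) < (2 * k / U) ^ k := by positivity
  rw [← mul_le_mul_iff_right₀ hpow]
  refine hbound.trans ?_
  calc ((2 * k).factorial : ℝ) * (2 * Real.exp k) ≤ (2 * k) ^ (2 * k) * (2 * Real.exp k) := by
        gcongr
    _ = _ := by
        rw [pow_mul, mul_left_comm, mul_left_comm ((2 * k / U) ^ k), ← mul_pow,
          show 2 * (k : ℝ) / U * (2 * Real.exp 1 * k * U) = (2 * k) ^ 2 * Real.exp 1 by
            field_simp, mul_pow _ (Real.exp 1), ← Real.exp_nat_mul, mul_one]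

end GaussianMoments

/-! ### Continuity in the margins -/

theorem sqShift_nonneg (X : Fin n → Tensor p) (B₀ B : Tensor p) : 0 ≤ sqShift X B₀ B :=
  Finset.sum_nonneg fun _ _ => sq_nonneg _

theorem continuous_parafac : Continuous (parafac : Margins R p → Tensor p) := by
  unfold parafac
  refine (PiLp.continuous_toLp 2 _).comp ?_
  fun_prop

theorem continuous_meanShift (X : Fin n → Tensor p) (B₀ : Tensor p) (i : Fin n) :
    Continuous fun F : Margins R p => meanShift X B₀ (parafac F) i :=
  (continuous_const.inner continuous_parafac).sub continuous_const

theorem continuous_sqShift (X : Fin n → Tensor p) (B₀ : Tensor p) :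
    Continuous fun F : Margins R p => sqShift X B₀ (parafac F) :=
  continuous_finsetSum _ fun i _ => (continuous_meanShift X B₀ i).pow 2

theorem continuous_noisePairing (X : Fin n → Tensor p) (B₀ : Tensor p) (y : Fin n → ℝ) :
    Continuous fun F : Margins R p => noisePairing X B₀ (parafac F) y :=
  continuous_finsetSum _ fun i _ => continuous_const.mul (continuous_meanShift X B₀ i)

theorem isOpen_priorBall (X : Fin n → Tensor p) (B₀ : Tensor p) (ρ η : ℝ) :
    IsOpen (priorBall X B₀ ρ η : Set (Margins R p)) :=
  isOpen_lt (continuous_const.mul (continuous_parafac.sub continuous_const).norm) continuous_const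

/-! ### The noise pairing as a polynomial in the margins -/

/-- For fixed data, `noisePairing X B₀ (parafac F) y` as a polynomial in the entries of the margins
`F`; the variable `(r, ⟨j, l⟩)` stands for the entry `F r j l`. -/
noncomputable def pairingPoly (R : ℕ) (X : Fin n → Tensor p) (B₀ : Tensor p) (y : Fin n → ℝ) :
    MvPolynomial (Fin R × Σ j, Fin (p j)) ℝ :=
  ∑ i, MvPolynomial.C (y i - inner ℝ (X i) B₀) *
    (∑ k, (∑ r, ∏ j, MvPolynomial.X (r, ⟨j, k j⟩)) * MvPolynomial.C (X i k) -
      MvPolynomial.C (inner ℝ (X i) B₀))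

theorem eval_pairingPoly (X : Fin n → Tensor p) (B₀ : Tensor p) (y : Fin n → ℝ)
    (F : Margins R p) :
    MvPolynomial.eval (fun s => F s.1 s.2.1 s.2.2) (pairingPoly R X B₀ y) =
      noisePairing X B₀ (parafac F) y := by
  simp only [pairingPoly, noisePairing, meanShift, map_sum, map_mul, map_sub, map_prod,
    MvPolynomial.eval_C, MvPolynomial.eval_X]
  refine Finset.sum_congr rfl fun i _ => ?_
  rw [PiLp.inner_apply (X i) (parafac F)]
  rfl

theorem totalDegree_pairingPoly_le (X : Fin n → Tensor p) (B₀ : Tensor p) (y : Fin n → ℝ) :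
    (pairingPoly R X B₀ y).totalDegree ≤ D := by
  refine MvPolynomial.totalDegree_finsetSum_le fun i _ => ?_
  refine (MvPolynomial.totalDegree_mul _ _).trans ?_
  rw [MvPolynomial.totalDegree_C, zero_add]
  refine (MvPolynomial.totalDegree_sub _ _).trans (max_le ?_ (by simp))
  refine MvPolynomial.totalDegree_finsetSum_le fun k _ => ?_
  refine (MvPolynomial.totalDegree_mul _ _).trans ?_
  rw [MvPolynomial.totalDegree_C, add_zero]
  refine MvPolynomial.totalDegree_finsetSum_le fun r _ => ?_
  refine (MvPolynomial.totalDegree_finsetProd _ _).trans ?_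
  simp

/-! ### Uniform control of the noise -/

/-- The maximal inequality for the functions `y ↦ ⟨e, δ(F)⟩ ^ k`, where `F` ranges over all margins:
they are polynomials in `F` of degree at most `k * D`. The exponent `k` and the weight `x` are free
parameters. -/
theorem dataLaw_exists_lt_sq_le (X : Fin n → Tensor p) (B₀ : Tensor p) {k : ℕ} (hk : 0 < k)
    {T x : ℝ} (hT : 0 < T) (hx0 : 0 < x) (hx1 : x < 1) :
    dataLaw X B₀ {y | ∃ F : Margins R p,
        T * sqShift X B₀ (parafac F) < noisePairing X B₀ (parafac F) y ^ 2} ≤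
      ENNReal.ofReal (x⁻¹ ^ (k * D) * (1 - x)⁻¹ ^ (R * ∑ j, p j) *
        (2 * (2 * Real.exp 1 * k / T) ^ k)) := by
  set f : Margins R p → (Fin n → ℝ) → ℝ := fun F y => noisePairing X B₀ (parafac F) y ^ k with hf
  set g : ((Fin R × Σ j, Fin (p j)) → ℝ) → (Fin n → ℝ) → ℝ :=
    fun z y => MvPolynomial.eval z (pairingPoly R X B₀ y ^ k) with hg
  have hfg : Set.range f ⊆ Set.range g := by
    rintro _ ⟨F, rfl⟩
    refine ⟨fun s => F s.1 s.2.1 s.2.2, ?_⟩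
    ext y
    simp only [hg, hf, map_pow, eval_pairingPoly]
  obtain ⟨hfin, hrank⟩ := finrank_span_eval_le (fun y => pairingPoly R X B₀ y ^ k)
    (K := k * D) (fun y => (MvPolynomial.totalDegree_pow _ _).trans
      (Nat.mul_le_mul_left _ (totalDegree_pairingPoly_le X B₀ y))) hx0 hx1
  have hle : Submodule.span ℝ (Set.range f) ≤ Submodule.span ℝ (Set.range g) :=
    Submodule.span_mono hfg
  have : FiniteDimensional ℝ (Submodule.span ℝ (Set.range f)) :=
    Submodule.finiteDimensional_of_le hle
  have hk' : (0 : ℝ) < k := by exact_mod_cast hk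
  have hmom := fun F : Margins R p =>
    gaussian_pairing_moment (fun i => inner ℝ (X i) B₀) (meanShift X B₀ (parafac F)) hk
  have key := measure_exists_lt_sq_le (μ := dataLaw X B₀) (f := f)
    (C := fun F => 2 * (2 * Real.exp 1 * k * sqShift X B₀ (parafac F)) ^ k)
    (fun y => (continuous_noisePairing X B₀ y).pow k)
    (continuous_const.mul ((continuous_const.mul (continuous_sqShift X B₀)).pow k))
    (fun F => (hmom F).1) (fun F => (hmom F).2)
    (t := (T / (2 * Real.exp 1 * k)) ^ k / 2) (by positivity)
  refine (measure_mono ?_).trans (key.trans (ENNReal.ofReal_le_ofReal ?_))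
  · rintro y ⟨F, hF⟩
    refine ⟨F, ?_⟩
    have h0 := sqShift_nonneg X B₀ (parafac F)
    calc (T / (2 * Real.exp 1 * k)) ^ k / 2 *
          (2 * (2 * Real.exp 1 * k * sqShift X B₀ (parafac F)) ^ k)
        = (T / (2 * Real.exp 1 * k) * (2 * Real.exp 1 * k * sqShift X B₀ (parafac F))) ^ k := by
          rw [mul_pow (T / _)]
          ring
      _ = (T * sqShift X B₀ (parafac F)) ^ k := by
          congr 1
          field_simp
      _ < (noisePairing X B₀ (parafac F) y ^ 2) ^ k :=
          pow_lt_pow_left₀ hF (by positivity) hk.ne'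
      _ = f F y ^ 2 := by rw [hf, ← pow_mul, ← pow_mul, mul_comm]
  · have h1 : (Module.finrank ℝ (Submodule.span ℝ (Set.range f)) : ℝ) ≤
        x⁻¹ ^ (k * D) * (1 - x)⁻¹ ^ (R * ∑ j, p j) := by
      refine le_trans (by exact_mod_cast Submodule.finrank_mono hle) (hrank.trans_eq ?_)
      simp
    calc _ = (Module.finrank ℝ (Submodule.span ℝ (Set.range f)) : ℝ) *
          (2 * (2 * Real.exp 1 * k / T) ^ k) := by
          rw [div_div_eq_mul_div, div_pow, div_pow]
          field_simp
      _ ≤ _ := mul_le_mul_of_nonneg_right h1 (by positivity)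

/-- With probability exponentially close to one, `⟨e, δ(F)⟩² ≤ τ n ‖δ(F)‖²` simultaneously for all
margins `F`. The power `k` grows like `a n` for a small `a`, so that the Gaussian moment gains a factor
`exp (-k)`, of which the dimension bound takes back at most `exp (k / 2 + o(n))`. -/
theorem eventually_dataLaw_exists_lt_sq_le {D R : ℕ} {p : ℕ → Fin D → ℕ}
    (hp : (fun n : ℕ => (R : ℝ) * ∑ j, (p n j : ℝ)) =o[atTop] fun n : ℕ => (n : ℝ))
    (X : (n : ℕ) → Fin n → Tensor (p n)) (B₀ : (n : ℕ) → Tensor (p n)) {τ : ℝ} (hτ : 0 < τ) :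
    ∃ c K : ℝ, 0 < c ∧ ∀ᶠ n : ℕ in atTop,
      dataLaw (X n) (B₀ n) {y | ∃ F : Margins R (p n), τ * n * sqShift (X n) (B₀ n) (parafac F) <
        noisePairing (X n) (B₀ n) (parafac F) y ^ 2} ≤ ENNReal.ofReal (K * Real.exp (-c * n)) := by
  -- weight per unit of degree, so small that `x⁻¹ ^ (k * D) ≤ exp (k / 2)`
  set x : ℝ := Real.exp (-(1 / (2 * (D + 1)))) with hx
  have hx0 : 0 < x := Real.exp_pos _
  have hx1 : x < 1 := Real.exp_lt_one_iff.2 (by rw [neg_lt_zero]; positivity)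
  set ℓ : ℝ := -Real.log (1 - x) with hℓ
  have hℓ0 : 0 < ℓ := neg_pos.2 (Real.log_neg (by linarith) (by linarith))
  set a : ℝ := τ / (2 * Real.exp 2) with ha
  have ha0 : 0 < a := by positivity
  refine ⟨a / 4, 2 * Real.exp (1 / 2), by positivity, ?_⟩
  have hm := hp.bound (show 0 < a / 4 / ℓ by positivity)
  filter_upwards [hm, eventually_ge_atTop 1, eventually_ge_atTop ⌈1 / a⌉₊] with n hm hn hna
  have hn0 : (0 : ℝ) < n := by exact_mod_cast hn
  set k := ⌊a * n⌋₊ with hk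
  have hkle : (k : ℝ) ≤ a * n := Nat.floor_le (by positivity)
  have hklt : a * n < k + 1 := Nat.lt_floor_add_one _
  have hkpos : 0 < k := by
    refine Nat.floor_pos.2 ?_
    have := (Nat.le_ceil (1 / a)).trans (Nat.cast_le.2 hna)
    rwa [div_le_iff₀' ha0] at this
  refine (dataLaw_exists_lt_sq_le (X n) (B₀ n) hkpos (by positivity) hx0 hx1).trans
    (ENNReal.ofReal_le_ofReal ?_)
  have h1 : x⁻¹ ^ (k * D) ≤ Real.exp (k / 2) := by
    rw [hx, ← Real.exp_neg, neg_neg, ← Real.exp_nat_mul]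
    refine Real.exp_le_exp.2 ?_
    push_cast
    rw [mul_one_div, div_le_div_iff₀ (by positivity) two_pos]
    nlinarith [(Nat.cast_nonneg k : (0 : ℝ) ≤ k)]
  have h2 : (1 - x)⁻¹ ^ (R * ∑ j, p n j) ≤ Real.exp (a / 4 * n) := by
    have : (1 - x)⁻¹ = Real.exp ℓ := by
      rw [hℓ, Real.exp_neg, Real.exp_log (by linarith)]
    rw [this, ← Real.exp_nat_mul]
    refine Real.exp_le_exp.2 ?_
    rw [Real.norm_of_nonneg (by positivity), Real.norm_of_nonneg hn0.le, div_mul_eq_mul_div,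
      le_div_iff₀ hℓ0] at hm
    push_cast
    exact hm
  have h3 : (2 * Real.exp 1 * k / (τ * n)) ^ k ≤ Real.exp (-k) := by
    have : 2 * Real.exp 1 * k / (τ * n) ≤ Real.exp (-1) := by
      rw [div_le_iff₀ (by positivity)]
      calc 2 * Real.exp 1 * k ≤ 2 * Real.exp 1 * (a * n) := by gcongr
        _ = Real.exp (-1) * (τ * n) := by
          rw [ha, show Real.exp 2 = Real.exp 1 * Real.exp 1 by rw [← Real.exp_add]; norm_num,
            Real.exp_neg]
          field_simp
    calc _ ≤ Real.exp (-1) ^ k := pow_le_pow_left₀ (by positivity) this k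
      _ = _ := by rw [← Real.exp_nat_mul]; simp
  calc _ ≤ Real.exp (k / 2) * Real.exp (a / 4 * n) * (2 * Real.exp (-k)) := by
        have : 0 < (1 - x)⁻¹ := inv_pos.2 (by linarith)
        gcongr
    _ = 2 * Real.exp (k / 2 + a / 4 * n - k) := by
        rw [sub_eq_add_neg, Real.exp_add, Real.exp_add]
        ring
    _ ≤ 2 * Real.exp (1 / 2 + -(a / 4) * n) := by
        gcongr
        linarith
    _ = _ := by rw [Real.exp_add, mul_assoc]

/-! ### The prior ball -/

theorem designSize_nonneg (X : Fin n → Tensor p) : 0 ≤ designSize X :=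
  mul_nonneg (by positivity) (Real.sqrt_nonneg _)

theorem zeta_nonneg (ρ : ℝ) (n : ℕ) : 0 ≤ zeta ρ n :=
  Real.rpow_nonneg n.cast_nonneg _

/-- Cauchy–Schwarz, since `n M_n = √(∑ ‖X_i‖²)`. -/
theorem sqShift_le (X : Fin n → Tensor p) (B₀ B : Tensor p) (hn : 0 < n) :
    sqShift X B₀ B ≤ (n * designSize X * ‖B - B₀‖) ^ 2 := by
  have hn' : (n : ℝ) ≠ 0 := by exact_mod_cast hn.ne'
  have : (n : ℝ) * designSize X = √(∑ i, ‖X i‖ ^ 2) := by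
    rw [designSize, ← mul_assoc, mul_one_div_cancel hn', one_mul]
  rw [this, mul_pow, Real.sq_sqrt (by positivity), Finset.sum_mul]
  refine Finset.sum_le_sum fun i _ => ?_
  rw [meanShift, ← inner_sub_right, ← mul_pow, ← sq_abs]
  exact pow_le_pow_left₀ (abs_nonneg _) (abs_real_inner_le_norm _ _) 2

/-- On the prior ball `‖δ‖² ≤ (4 η² / 9) n ^ (1 - ρ) = o(n)`. -/
theorem eventually_sqShift_le_of_mem_priorBall {D R : ℕ} {p : ℕ → Fin D → ℕ}
    (X : (n : ℕ) → Fin n → Tensor (p n)) (B₀ : (n : ℕ) → Tensor (p n)) {ρ η γ : ℝ}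
    (hρ : 0 < ρ) (hγ : 0 < γ) :
    ∀ᶠ n : ℕ in atTop, ∀ F ∈ (priorBall (X n) (B₀ n) ρ η : Set (Margins R (p n))),
      sqShift (X n) (B₀ n) (parafac F) ≤ γ * n := by
  have hlim : Tendsto (fun n : ℕ => (n : ℝ) ^ ρ) atTop atTop :=
    (tendsto_rpow_atTop hρ).comp tendsto_natCast_atTop_atTop
  filter_upwards [hlim.eventually_ge_atTop (4 * η ^ 2 / (9 * γ)), eventually_gt_atTop 0]
    with n hlarge hn F hF
  have hn0 : (0 : ℝ) < n := by exact_mod_cast hn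
  set M := designSize (X n) with hM
  set b := ‖parafac F - B₀ n‖ with hb
  have hF' : 3 * M * zeta ρ n * b < 2 * η := hF
  have hM0 : 0 ≤ M := designSize_nonneg _
  have hz0 : 0 ≤ zeta ρ n := zeta_nonneg _ _
  have hz : zeta ρ n ^ 2 = n * (n : ℝ) ^ ρ := by
    rw [zeta, ← Real.rpow_natCast, ← Real.rpow_mul hn0.le,
      ← Real.rpow_one_add' hn0.le (by positivity)]
    congr 1
    push_cast
    ring
  have hsq : (3 * M * zeta ρ n * b) ^ 2 ≤ (2 * η) ^ 2 :=
    pow_le_pow_left₀ (by positivity) hF'.le 2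
  have hpow : (0 : ℝ) < (n : ℝ) ^ ρ := Real.rpow_pos_of_pos hn0 ρ
  rw [div_le_iff₀ (by positivity)] at hlarge
  have hmain : 9 * (n : ℝ) ^ ρ * (n * M * b) ^ 2 ≤ 9 * (n : ℝ) ^ ρ * (γ * n) := by
    calc 9 * (n : ℝ) ^ ρ * (n * M * b) ^ 2 = n * (3 * M * zeta ρ n * b) ^ 2 := by
          rw [mul_pow (3 * M * zeta ρ n), mul_pow (3 * M), hz]
          ring
      _ ≤ n * (2 * η) ^ 2 := by gcongr
      _ ≤ n * ((n : ℝ) ^ ρ * (9 * γ)) := by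
          gcongr
          linarith
      _ = _ := by ring
  exact (sqShift_le _ _ _ hn).trans (le_of_mul_le_mul_left hmain (by positivity))

/-! ### The posterior mass -/

/-- Data for which `⟨e, δ⟩² ≤ (ε / 8) n ‖δ‖²` holds throughout have an exponentially small posterior
mass of the set where the average divergence exceeds `ε`: there the likelihood ratio is at most
`exp (-ε n / 2)`, while on `S` it is at least `exp (-5 ε n / 64)`. -/
theorem posteriorMass_le (X : Fin n → Tensor p) (B₀ : Tensor p) (π : Measure (Margins R p))
    [IsProbabilityMeasure π] (y : Fin n → ℝ) {ε d : ℝ} (hn : 0 < n) (hε : 0 < ε) (hd : d < ε / 32)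
    {S : Set (Margins R p)} (hSm : MeasurableSet S)
    (hS : ∀ F ∈ S, sqShift X B₀ (parafac F) ≤ ε / 32 * n)
    (hprior : ENNReal.ofReal (Real.exp (-d * n)) ≤ π S)
    (hgood : ∀ F : Margins R p, noisePairing X B₀ (parafac F) y ^ 2 ≤
      ε / 8 * n * sqShift X B₀ (parafac F)) :
    posteriorMass X π y {F | ENNReal.ofReal ε < avgKL X B₀ (parafac F)} ≤
      ENNReal.ofReal (Real.exp (-(ε / 4) * n)) := by
  have hn0 : (0 : ℝ) < n := by exact_mod_cast hn
  set A : Set (Margins R p) := {F | ENNReal.ofReal ε < avgKL X B₀ (parafac F)} with hA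
  have hA' : A = {F | 2 * n * ε < sqShift X B₀ (parafac F)} := by
    ext F
    have hdiv : avgKL X B₀ (parafac F) =
        ENNReal.ofReal (sqShift X B₀ (parafac F) / 2 / n) := by
      rw [avgKL_eq, ENNReal.ofReal_div_of_pos hn0, ENNReal.ofReal_natCast]
    rw [hA, Set.mem_ofPred_eq, Set.mem_ofPred_eq, hdiv, ENNReal.ofReal_lt_ofReal_iff_of_nonneg hε.le,
      lt_div_iff₀ hn0, lt_div_iff₀ two_pos]
    constructor <;> intro h <;> linarith
  have hAm : MeasurableSet A := by
    rw [hA']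
    exact (isOpen_lt continuous_const (continuous_sqShift X B₀)).measurableSet
  have hL0 : likelihood X B₀ y ≠ 0 :=
    Finset.prod_ne_zero_iff.2 fun i _ => (gaussianPDF_pos _ one_ne_zero _).ne'
  have hLtop : likelihood X B₀ y ≠ ∞ := ENNReal.prod_ne_top fun i _ => gaussianPDF_ne_top
  have hnum : ∫⁻ F in A, likelihood X (parafac F) y ∂π ≤
      likelihood X B₀ y * ENNReal.ofReal (Real.exp (-(ε / 2) * n)) := by
    calc _ ≤ ∫⁻ _ in A, likelihood X B₀ y * ENNReal.ofReal (Real.exp (-(ε / 2) * n)) ∂π := by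
          refine setLIntegral_mono' hAm fun F hF => ?_
          rw [likelihood_eq X B₀]
          have hF' : 2 * n * ε < sqShift X B₀ (parafac F) := by
            rw [hA'] at hF
            exact hF
          -- `‖δ‖² > 2 n ε` turns the bound on `⟨e, δ⟩²` into `⟨e, δ⟩² ≤ (‖δ‖² / 4)²`
          have hp : noisePairing X B₀ (parafac F) y ≤ sqShift X B₀ (parafac F) / 4 := by
            refine le_of_abs_le (abs_le_of_sq_le_sq ?_ (by linarith [sqShift_nonneg X B₀ (parafac F)]))
            have h16 : ε / 8 * n ≤ sqShift X B₀ (parafac F) / 16 := by linarith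
            refine (hgood F).trans ?_
            calc _ ≤ sqShift X B₀ (parafac F) / 16 * sqShift X B₀ (parafac F) :=
                  mul_le_mul_of_nonneg_right h16 (sqShift_nonneg _ _ _)
              _ = _ := by ring
          gcongr
          change noisePairing X B₀ (parafac F) y - sqShift X B₀ (parafac F) / 2 ≤ _
          linarith
      _ ≤ _ := by
          rw [setLIntegral_const]
          exact mul_le_of_le_one_right' prob_le_one
  have hden : likelihood X B₀ y * ENNReal.ofReal (Real.exp (-(ε / 4) * n)) ≤
      ∫⁻ F, likelihood X (parafac F) y ∂π := by
    calc _ ≤ likelihood X B₀ y * ENNReal.ofReal (Real.exp (-(5 * ε / 64) * n)) *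
          ENNReal.ofReal (Real.exp (-d * n)) := by
          rw [mul_assoc, ← ENNReal.ofReal_mul (Real.exp_pos _).le, ← Real.exp_add]
          gcongr
          nlinarith
      _ ≤ likelihood X B₀ y * ENNReal.ofReal (Real.exp (-(5 * ε / 64) * n)) * π S := by gcongr
      _ = ∫⁻ _ in S, likelihood X B₀ y * ENNReal.ofReal (Real.exp (-(5 * ε / 64) * n)) ∂π := by
          rw [setLIntegral_const]
      _ ≤ ∫⁻ F in S, likelihood X (parafac F) y ∂π := by
          refine setLIntegral_mono' hSm fun F hF => ?_
          rw [likelihood_eq X B₀ (parafac F)]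
          have hs := hS F hF
          have hp : |noisePairing X B₀ (parafac F) y| ≤ ε * n / 16 := by
            refine abs_le_of_sq_le_sq ((hgood F).trans ?_) (by positivity)
            calc ε / 8 * n * sqShift X B₀ (parafac F) ≤ ε / 8 * n * (ε / 32 * n) := by gcongr
              _ = _ := by ring
          gcongr
          change _ ≤ noisePairing X B₀ (parafac F) y - sqShift X B₀ (parafac F) / 2
          linarith [neg_le_of_abs_le hp]
      _ ≤ _ := setLIntegral_le_lintegral _ _
  calc posteriorMass X π y A
      ≤ (likelihood X B₀ y * ENNReal.ofReal (Real.exp (-(ε / 2) * n))) /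
        (likelihood X B₀ y * ENNReal.ofReal (Real.exp (-(ε / 4) * n))) :=
        ENNReal.div_le_div hnum hden
    _ = ENNReal.ofReal (Real.exp (-(ε / 4) * n)) := by
        rw [ENNReal.mul_div_mul_left _ _ hL0 hLtop, ← ENNReal.ofReal_div_of_pos (Real.exp_pos _),
          ← Real.exp_sub]
        congr 2
        ring

end TensorRegression

open TensorRegression in
theorem theorem4p1
    -- the number of modes, the parafac rank, and the tensor dimensions `p_{j,n}`
    (D R : ℕ) (p : ℕ → Fin D → ℕ)
    (hp : (fun n : ℕ => (R : ℝ) * ∑ j, (p n j : ℝ)) =o[atTop] fun n : ℕ => (n : ℝ))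
    -- the tensor predictors `X_i` for sample size `n`, and the true margins
    (X : (n : ℕ) → Fin n → Tensor (p n))
    (F₀ : (n : ℕ) → Margins R (p n))
    -- the data for sample size `n`, on one probability space, generated under `B_n^0`
    {Ω : Type*} [MeasurableSpace Ω] (P : Measure Ω) [IsProbabilityMeasure P]
    (y : (n : ℕ) → Ω → (Fin n → ℝ))
    (hy : ∀ n, HasLaw (y n) (dataLaw (X n) (parafac (F₀ n))) P)
    -- the priors
    (π : (n : ℕ) → Measure (Margins R (p n))) [∀ n, IsProbabilityMeasure (π n)]
    (ρ₃ ε d η : ℝ) (hρ₃ : 0 < ρ₃) (hε : 0 < ε) (hd : 0 < d) (hη : η < ε / 32 - d)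
    (hprior : ∀ᶠ n : ℕ in atTop,
      ENNReal.ofReal (Real.exp (-d * n)) < π n (priorBall (X n) (parafac (F₀ n)) ρ₃ η)) :
    ∀ᵐ ω ∂P, Tendsto
      (fun n : ℕ => posteriorMass (X n) (π n) (y n ω)
        {F | ENNReal.ofReal ε < avgKL (X n) (parafac (F₀ n)) (parafac F)})
      atTop (𝓝 0) := by
  -- the prior ball is nonempty, which forces `η > 0`; hence `d < ε / 32`
  have hη0 : 0 < η := by
    obtain ⟨n, hn⟩ := hprior.exists
    obtain ⟨F, hF⟩ := nonempty_of_measure_ne_zero (pos_of_gt hn).ne'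
    have hF' : 3 * designSize (X n) * zeta ρ₃ n * ‖parafac F - parafac (F₀ n)‖ < 2 * η := hF
    have : 0 ≤ 3 * designSize (X n) * zeta ρ₃ n * ‖parafac F - parafac (F₀ n)‖ :=
      mul_nonneg (mul_nonneg (mul_nonneg zero_le_three (designSize_nonneg _)) (zeta_nonneg _ _))
        (norm_nonneg _)
    linarith
  obtain ⟨c, K, hc, hbad⟩ := eventually_dataLaw_exists_lt_sq_le hp X (fun n => parafac (F₀ n))
    (τ := ε / 8) (by positivity)
  obtain ⟨N, hN⟩ := eventually_atTop.1 hbad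
  -- the sets are emptied for `n < N`, where the exponential bound need not hold
  set bad : ℕ → Set Ω := fun n => {ω | N ≤ n ∧ ∃ F : Margins R (p n),
    ε / 8 * n * sqShift (X n) (parafac (F₀ n)) (parafac F) <
      noisePairing (X n) (parafac (F₀ n)) (parafac F) (y n ω) ^ 2} with hbad_def
  have hmeas : ∀ n, P (bad n) ≤ ENNReal.ofReal (K * Real.exp (-c * n)) := fun n => by
    by_cases hn : N ≤ n
    · refine le_trans ?_ (hN n hn)
      rw [← (hy n).map_eq]
      exact (measure_mono fun ω hω => hω.2).trans (Measure.le_map_apply (hy n).aemeasurable _)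
    · simp [hbad_def, hn]
  have hsum : ∑' n, P (bad n) ≠ ∞ := by
    refine ne_top_of_le_ne_top ?_ (ENNReal.tsum_le_tsum hmeas)
    refine Summable.tsum_ofReal_ne_top (Summable.mul_left K ?_)
    simpa [mul_comm] using Real.summable_exp_nat_mul_iff.2 (neg_lt_zero.2 hc)
  have hball := eventually_sqShift_le_of_mem_priorBall (R := R) X (fun n => parafac (F₀ n))
    (η := η) hρ₃ (show 0 < ε / 32 by positivity)
  have hlim : Tendsto (fun n : ℕ => ENNReal.ofReal (Real.exp (-(ε / 4) * n))) atTop (𝓝 0) := by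
    rw [← ENNReal.ofReal_zero]
    refine ENNReal.tendsto_ofReal (Real.tendsto_exp_atBot.comp ?_)
    exact tendsto_natCast_atTop_atTop.const_mul_atTop_of_neg (by linarith)
  filter_upwards [ae_eventually_notMem hsum] with ω hω
  refine tendsto_of_tendsto_of_tendsto_of_le_of_le' tendsto_const_nhds hlim
    (Eventually.of_forall fun n => bot_le) ?_
  filter_upwards [hω, hball, hprior, eventually_gt_atTop 0, eventually_ge_atTop N]
    with n hωn hballn hpn hn0 hnN
  refine posteriorMass_le (X n) (parafac (F₀ n)) (π n) (y n ω) hn0 hε (by linarith)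
    (isOpen_priorBall _ _ _ _).measurableSet hballn hpn.le fun F => ?_
  exact le_of_not_gt fun hlt => hωn ⟨hnN, F, hlt⟩
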